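/- Let $\mathcal X$ be a finite set of items, $n\in\mathbb N$, and let $\mathcal S$ be the collection of nonempty choice sets $s\subseteq\mathcal X$ with $|s|\le n$. An aggregation mechanism $M=(w,\varphi)$ consists of a weight $w$, a real function of finite sets of reals, and an embedding $\varphi$, a real function of a real number and a finite set of reals. It combines score functions $f=(f_1,\dots,f_\ell)$, $f_i:\mathcal X\to\mathbb R$, into $$g_f(x,s)=\langle w(s),\varphi(x,s)\rangle=\sum_{i=1}^{\ell} w(f_i(s))\,\varphi(f_i(x),f_i(s)),\qquad f_i(s)=\{f_i(z):z\in s\}$$ (and likewise on any other set of items). For a class $H$ of score functions let $\mathcal G^{(\ell)}_H=\{g_f: f\in H^\ell\}$. Assume that * $M$ is scale-invariant: there is an odd bijection $\Phi:\mathbb R\to\mathbb R$ with $g_{\alpha u}(x,s)=\Phi(\alpha)\,g_u(x,s)$ for all $\alpha>0$, all finite tuples $u$ of utilities on a finite item set, all sets $s$ of these items and all $x\in s$; * $M$ has a triple basis: there are $u_1,\dots,u_k\in\mathbb R^3$, viewed as utilities of three items $x_1,x_2,x_3$, with $g_u(x_1,\{x_1,x_2\})>g_u(x_2,\{x_1,x_2\})$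 and $g_u(x,s)=g_u(x',s)$ for every other $s\subseteq\{x_1,x_2,x_3\}$ and all $x,x'\in s$. For a distribution $D$ on $\mathcal S\times\mathcal X$ let $\varepsilon_D(g)=P_{(s,y)\sim D}\big(\operatorname{argmax}_{x\in s}g(x,s)\neq\{y\}\big)$ be the risk (a tie counts as an error), and let $\varepsilon^*_D(\mathcal G)=\min_{g\in\mathcal G}\varepsilon_D(g)$ be the approximation error of a class $\mathcal G$. Then there is $\ell_0$ such that for every $\ell\ge\ell_0$, every choice function $c:\mathcal S\to\mathcal X$ ($c(s)\in s$ for all $s$) and every distribution $D$ on $\mathcal S\times\mathcal X$ under which $y=c(s)$ almost surely: 1. $\varepsilon^*_D(\mathcal G^{(\ell)}_{H})=0$ if $H$ is the class of all functions $\mathcal X\to\mathbb R$; 2. if on every choice set the aggregated scores of $M$ depend continuously on the utilities of the items, then $\varepsilon^*_D(\mathcal G^{(\ell)}_{H})=0$ for every class $H\supseteq F_+$, in particular for $H=F_+$, where $F$ is any class of score functions that separates every choice set (for each $s\in\mathcal S$ some $f\in F$ satisfies $f(x)>f(x')$ for all $x\in s$, $x'\in\mathcal X\setminus s$), and $F_+=\{x\mapsto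 a(b(x),b'(x)) : b,b'\in F,\ a\in\mathcal N\}$, with $\mathcal N$ the class of networks with two inputs, two fully connected hidden layers of two units each with a sigmoidal activation $\sigma$ (limits $0$ and $1$ at $-\infty$ and $+\infty$), and an affine output. In each case the minimum defining $\varepsilon^*_D$ is attained. -/

import Mathlib

/-- The choice sets: all nonempty sets of at most `n` items from the item space `X`. -/
abbrev ChoiceSet (X : Type*) (n : ℕ) : Type _ :=
  {s : Finset X // s.Nonempty ∧ s.card ≤ n}

/-- A set-dependent aggregation mechanism, i.e. the functional form by which the scores
`f = (f₁, …, f_ℓ)` are combined into `g(x, s) = ⟨w(s), φ(x, s)⟩`. In each dimension the weight is a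
set function of the scores of the items of `s`, `w_i(s) = w (f_i(s))` with
`f_i(s) = {f_i(z) : z ∈ s}`, and the embedding is an item-centric set function,
`φ_i(x, s) = φ (f_i(x), f_i(s))`; for instance `φ (a, A) = μ (a - r A)` for a reference-point
function `r` and an evaluation function `μ`. -/
structure AggregationMechanism where
  /-- The weight `w`, a function of the set of scores. -/
  w : Finset ℝ → ℝ
  /-- The embedding `φ`, a function of the score of the item and the set of scores. -/
  φ : ℝ → Finset ℝ → ℝ

namespace AggregationMechanism

/-- The aggregator `g_f(x, s) = ⟨w(s), φ(x, s)⟩ = ∑ i, w (f_i(s)) * φ (f_i(x), f_i(s))`. -/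
noncomputable def agg (M : AggregationMechanism) {X : Type*} {ℓ : ℕ}
    (f : Fin ℓ → X → ℝ) (x : X) (s : Finset X) : ℝ :=
  ∑ i, M.w (s.image (f i)) * M.φ (f i x) (s.image (f i))

/-- Scale invariance: there is an invertible odd `Φ` with `g_{αu}(x, s) = Φ(α) g_u(x, s)` for every
`α > 0`, every number of utilities and every finite set of items. -/
def ScaleInvariant (M : AggregationMechanism) : Prop :=
  ∃ Φ : ℝ → ℝ, Function.Bijective Φ ∧ (∀ t, Φ (-t) = -Φ t) ∧
    ∀ α : ℝ, 0 < α → ∀ (m ℓ : ℕ) (u : Fin ℓ → Fin m → ℝ) (s : Finset (Fin m)), ∀ x ∈ s,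
      M.agg (α • u) x s = Φ α * M.agg u x s

/-- On every choice set the aggregated scores depend continuously on the utilities of the items. -/
def ContinuousInUtilities (M : AggregationMechanism) : Prop :=
  ∀ (m ℓ : ℕ) (s : Finset (Fin m)), ∀ x ∈ s,
    Continuous fun u : Fin ℓ → Fin m → ℝ => M.agg u x s

/-- `u = (u₁, …, u_k)`, `u_i ∈ ℝ³`, is a triple basis under `M` for the triple `(x₁, x₂, x₃)` (here
the items `0, 1, 2`): `x₁` is strictly preferred to `x₂` in `{x₁, x₂}`, and there is indifference on
every other choice set. -/
def IsTripleBasis (M : AggregationMechanism) {k : ℕ} (u : Fin k → Fin 3 → ℝ) : Prop :=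
  M.agg u 1 {0, 1} < M.agg u 0 {0, 1} ∧
    ∀ s : Finset (Fin 3), s ≠ {0, 1} → ∀ x ∈ s, ∀ x' ∈ s, M.agg u x s = M.agg u x' s

/-- The class `𝒢` of aggregators of dimension `ℓ` over a class `F` of item score functions. -/
def aggClass (M : AggregationMechanism) {X : Type*} (ℓ : ℕ) (F : Set (X → ℝ)) :
    Set (X → Finset X → ℝ) :=
  {g | ∃ f : Fin ℓ → X → ℝ, (∀ i, f i ∈ F) ∧ g = M.agg f}

end AggregationMechanism

/-- The score function `f` separates `s` if it scores every item of `s` strictly higher than every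
item outside `s`. -/
def Separates {X : Type*} (f : X → ℝ) (s : Finset X) : Prop :=
  ∀ x ∈ s, ∀ x' ∉ s, f x' < f x

/-- `F` is expressive for choice sets of size at most `n`: each of them is separated by a member. -/
def SeparatesChoiceSets {X : Type*} (F : Set (X → ℝ)) (n : ℕ) : Prop :=
  ∀ s : ChoiceSet X n, ∃ f ∈ F, Separates f s.1

/-- A sigmoidal activation, scaled to have the limits `0` and `1`. -/
def IsSigmoidal (σ : ℝ → ℝ) : Prop :=
  Filter.Tendsto σ Filter.atBot (nhds 0) ∧ Filter.Tendsto σ Filter.atTop (nhds 1)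

/-- The network with two inputs, two fully connected hidden layers of two units each with
activation `σ`, and an affine output. -/
def smallNet (σ : ℝ → ℝ) (A₁ : Matrix (Fin 2) (Fin 2) ℝ) (β₁ : Fin 2 → ℝ)
    (A₂ : Matrix (Fin 2) (Fin 2) ℝ) (β₂ : Fin 2 → ℝ) (a : Fin 2 → ℝ) (β : ℝ)
    (v : Fin 2 → ℝ) : ℝ :=
  a ⬝ᵥ (fun i => σ ((A₂.mulVec (fun j => σ ((A₁.mulVec v + β₁) j)) + β₂) i)) + β

/-- The enriched class `F₊ = {x ↦ a (b(x), b'(x)) : a a small network, b, b' ∈ F}`. -/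
def enrichedClass {X : Type*} (σ : ℝ → ℝ) (F : Set (X → ℝ)) : Set (X → ℝ) :=
  {f | ∃ (A₁ : Matrix (Fin 2) (Fin 2) ℝ) (β₁ : Fin 2 → ℝ) (A₂ : Matrix (Fin 2) (Fin 2) ℝ)
      (β₂ : Fin 2 → ℝ) (a : Fin 2 → ℝ) (β : ℝ), ∃ b ∈ F, ∃ b' ∈ F,
        f = fun x => smallNet σ A₁ β₁ A₂ β₂ a β ![b x, b' x]}

/-- The decision rule `h_g(s) = argmax_{x ∈ s} g(x, s)`, as the set of all maximizers. -/
def decision {X : Type*} (g : X → Finset X → ℝ) (s : Finset X) : Set X :=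
  {x | x ∈ s ∧ ∀ x' ∈ s, g x' s ≤ g x s}

open Classical in
/-- The 0/1 loss. A tie counts as an error: there is no loss only if `y` is the unique maximizer. -/
noncomputable def zeroOneLoss {X : Type*} (g : X → Finset X → ℝ) (s : Finset X) (y : X) : ℝ :=
  if decision g s = {y} then 0 else 1

/-- The expected risk of `g` when `(s, y)` is drawn from `D`. -/
noncomputable def risk {X : Type*} [Fintype X] {n : ℕ} (D : PMF (ChoiceSet X n × X))
    (g : X → Finset X → ℝ) : ℝ :=
  ∑ p : ChoiceSet X n × X, (D p).toReal * zeroOneLoss g p.1.1 p.2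

/-- The approximation error of the class `G` under `D`: the least expected risk over `G`. -/
noncomputable def approxError {X : Type*} [Fintype X] {n : ℕ} (D : PMF (ChoiceSet X n × X))
    (G : Set (X → Finset X → ℝ)) : ℝ :=
  sInf (risk D '' G)

/-!
Give every item a role relative to a choice set `s` with chosen item `y`: chosen (`x = y`), rejected
(`x ∈ s`, `x ≠ y`) or absent (`x ∉ s`). The triple basis, evaluated on these roles, prefers `y` to
the rest of `s` by a margin `δ`, is indifferent on every set that is not contained in `s`, and has
margins of at most `δ` in absolute value on every subset of `s`. Concatenate these scores over all
`s`, after `n - #s` of the dilations that multiply scores by a factor `B` larger than the number of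
choice sets. On `t`, the scores belonging to `t` then outweigh those belonging to all `s ⊃ t`
together, and those belonging to any other set are indifferent.

A function of the roles takes one value at `y`, one on `s \ {y}` and one off `s`. It is therefore a
limit of networks with increasing slopes that threshold a separator of `{y}` and a separator of `s`.
A strict preference is an open condition on the scores, so it survives the approximation.
-/

open Filter Topology

section LeadingTerm

variable {ι K : Type*} [Ring K] [LinearOrder K] [IsStrictOrderedRing K] {d : ι → ℕ} {B : K}

lemma sum_pow_lt_pow_of_card_lt {s : Finset ι} (hB : (s.card : K) < B) {m : ℕ}
    (hd : ∀ i ∈ s, d i < m) : ∑ i ∈ s, B ^ d i < B ^ m := by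
  have hB0 : 0 < B := (Nat.cast_nonneg _).trans_lt hB
  cases m with
  | zero =>
    rw [Finset.eq_empty_of_forall_notMem fun i hi => Nat.not_lt_zero _ (hd i hi)]
    simp
  | succ m =>
    have hpow : ∀ i ∈ s, B ^ d i ≤ B ^ m := fun i hi =>
      have hB1 : 1 ≤ B := le_trans (by exact_mod_cast Finset.card_pos.2 ⟨i, hi⟩) hB.le
      pow_le_pow_right₀ hB1 (Nat.lt_succ_iff.1 (hd i hi))
    calc ∑ i ∈ s, B ^ d i ≤ s.card * B ^ m := by
          simpa only [nsmul_eq_mul] using Finset.sum_le_card_nsmul s _ _ hpow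
      _ < B * B ^ m := mul_lt_mul_of_pos_right hB (pow_pos hB0 m)
      _ = B ^ (m + 1) := (pow_succ' B m).symm

lemma sum_pow_mul_pos_of_leading [Fintype ι] (hB : (Fintype.card ι : K) < B) {a : ι → K} {j : ι}
    (hj : 0 < a j) (hlow : ∀ i, d i < d j → -a j ≤ a i)
    (hhigh : ∀ i, i ≠ j → d j ≤ d i → 0 ≤ a i) : 0 < ∑ i, B ^ d i * a i := by
  classical
  have hB0 : 0 < B := (Nat.cast_nonneg _).trans_lt hB
  have hcard : ((Finset.univ.filter fun i => d i < d j).card : K) < B :=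
    (Nat.cast_le.2 (Finset.card_le_univ _)).trans_lt hB
  have hdom : ∑ i with d i < d j, B ^ d i < B ^ d j :=
    sum_pow_lt_pow_of_card_lt hcard fun i hi => (Finset.mem_filter.1 hi).2
  have hterm : ∀ i, (if i = j then B ^ d i * a j else 0) -
      (if d i < d j then B ^ d i * a j else 0) ≤ B ^ d i * a i := by
    intro i
    have hpow : 0 ≤ B ^ d i := (pow_pos hB0 _).le
    rcases eq_or_ne i j with rfl | hij
    · simp
    rcases lt_or_ge (d i) (d j) with hlt | hge
    · simpa [hij, hlt] using mul_le_mul_of_nonneg_left (hlow i hlt) hpow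
    · simpa [hij, hge.not_gt] using mul_nonneg hpow (hhigh i hij hge)
  calc 0 < (B ^ d j - ∑ i with d i < d j, B ^ d i) * a j := mul_pos (sub_pos.2 hdom) hj
    _ = ∑ i, ((if i = j then B ^ d i * a j else 0) -
          (if d i < d j then B ^ d i * a j else 0)) := by
        rw [Finset.sum_sub_distrib, Fintype.sum_ite_eq', ← Finset.sum_filter, ← Finset.sum_mul,
          sub_mul]
    _ ≤ ∑ i, B ^ d i * a i := Finset.sum_le_sum fun i _ => hterm i

end LeadingTerm

namespace AggregationMechanism

/-- The dilation of the utilities by `α` multiplies every aggregated score by `κ`. -/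
def ScalesBy (M : AggregationMechanism) (α κ : ℝ) : Prop :=
  ∀ (m ℓ : ℕ) (u : Fin ℓ → Fin m → ℝ) (s : Finset (Fin m)), ∀ x ∈ s,
    M.agg (α • u) x s = κ * M.agg u x s

/-- Discrete scale invariance: some dilation of the utilities multiplies every aggregated score by
a factor `κ > 1`. One such dilation takes the place of the one-parameter family of dilations of
`ScaleInvariant`. -/
def DiscretelyScaleInvariant (M : AggregationMechanism) : Prop :=
  ∃ α κ : ℝ, 1 < κ ∧ M.ScalesBy α κ

/-- The margin by which `x` beats `y` in the choice set `s`. Unlike the scores themselves, margins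
are not affected by appending constant score functions. -/
noncomputable def margin (M : AggregationMechanism) {X : Type*} {ℓ : ℕ} (f : Fin ℓ → X → ℝ)
    (x y : X) (s : Finset X) : ℝ :=
  M.agg f x s - M.agg f y s

section Scaling

variable {M : AggregationMechanism} {α β κ μ : ℝ}

lemma ScalesBy.mul (hα : M.ScalesBy α κ) (hβ : M.ScalesBy β μ) : M.ScalesBy (α * β) (κ * μ) :=
  fun m ℓ u s x hx => by rw [mul_smul, hα m ℓ _ s x hx, hβ m ℓ u s x hx, mul_assoc]

lemma ScalesBy.pow (h : M.ScalesBy α κ) (n : ℕ) : M.ScalesBy (α ^ n) (κ ^ n) := by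
  induction n with
  | zero => intro m ℓ u s x _; simp
  | succ n ih => simpa only [pow_succ] using ih.mul h

lemma ScalesBy.margin_smul (h : M.ScalesBy α κ) {m ℓ : ℕ} (u : Fin ℓ → Fin m → ℝ)
    {s : Finset (Fin m)} {x y : Fin m} (hx : x ∈ s) (hy : y ∈ s) :
    M.margin (α • u) x y s = κ * M.margin u x y s := by
  rw [margin, margin, h m ℓ u s x hx, h m ℓ u s y hy, mul_sub]

lemma ScaleInvariant.discretelyScaleInvariant (h : M.ScaleInvariant) :
    M.DiscretelyScaleInvariant := by
  obtain ⟨Φ, hΦ, hodd, hscale⟩ := h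
  obtain ⟨α, hα⟩ := hΦ.surjective 2
  -- Oddness only determines `Φ |α|` up to sign, so the dilation by `|α|` is applied twice.
  have hsq : Φ |α| ^ 2 = 4 := by
    rcases abs_choice α with h | h <;> rw [h] <;> norm_num [hodd, hα]
  have hα0 : α ≠ 0 := by
    rintro rfl
    have hΦ0 : Φ 0 = -Φ 0 := by simpa only [neg_zero] using hodd 0
    linarith
  have habs : M.ScalesBy |α| (Φ |α|) := hscale |α| (abs_pos.2 hα0)
  exact ⟨|α| ^ 2, Φ |α| ^ 2, by norm_num [hsq], habs.pow 2⟩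

lemma DiscretelyScaleInvariant.exists_scalesBy_gt (h : M.DiscretelyScaleInvariant) (C : ℝ) :
    ∃ α κ : ℝ, C < κ ∧ M.ScalesBy α κ := by
  obtain ⟨α, κ, hκ, hscale⟩ := h
  obtain ⟨n, hn⟩ := pow_unbounded_of_one_lt C hκ
  exact ⟨α ^ n, κ ^ n, hn, hscale.pow n⟩

end Scaling

section Combination

variable (M : AggregationMechanism) {X Y : Type*} {k ℓ : ℕ}

lemma agg_comp [DecidableEq Y] (f : Fin ℓ → Y → ℝ) (p : X → Y) (x : X) (s : Finset X) :
    M.agg (fun i => f i ∘ p) x s = M.agg f (p x) (s.image p) := by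
  simp only [agg, Finset.image_image, Function.comp_apply]

lemma margin_comp [DecidableEq Y] (f : Fin ℓ → Y → ℝ) (p : X → Y) (x y : X) (s : Finset X) :
    M.margin (fun i => f i ∘ p) x y s = M.margin f (p x) (p y) (s.image p) := by
  rw [margin, margin, agg_comp, agg_comp]

lemma exists_margin_eq_sum {ι : Type*} [Fintype ι] (h : ι → Fin k → X → ℝ)
    (hℓ : Fintype.card ι * k ≤ ℓ) :
    ∃ f : Fin ℓ → X → ℝ, (∀ j, f j = 0 ∨ ∃ i a, f j = h i a) ∧
      ∀ x y s, M.margin f x y s = ∑ i, M.margin (h i) x y s := by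
  obtain ⟨e⟩ : Nonempty (ι × Fin k ↪ Fin ℓ) :=
    Function.Embedding.nonempty_of_card_le (by simpa using hℓ)
  refine ⟨Function.extend e (fun q => h q.1 q.2) 0, fun j => ?_, fun x y s => ?_⟩
  · by_cases hj : ∃ q, e q = j
    · obtain ⟨q, rfl⟩ := hj
      exact Or.inr ⟨q.1, q.2, e.injective.extend_apply _ _ q⟩
    · exact Or.inl (Function.extend_apply' _ _ j hj)
  · simp only [margin, agg, ← Finset.sum_sub_distrib]
    rw [← Fintype.sum_prod_type']
    refine (Fintype.sum_of_injective e e.injective _ _ (fun j hj => ?_) fun q => ?_).symm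
    · rw [Function.extend_apply' _ _ j hj]
      exact sub_self _
    · rw [e.injective.extend_apply]

end Combination

end AggregationMechanism

/-- The role of the item `x` relative to a set `s` with chosen item `y`: chosen, rejected or absent,
numbered `0`, `1`, `2` like the items of a triple basis. -/
def itemRole {X : Type*} [DecidableEq X] (s : Finset X) (y x : X) : Fin 3 :=
  if x = y then 0 else if x ∈ s then 1 else 2

section ItemRole

variable {X : Type*} [DecidableEq X] {s t : Finset X} {x y : X}

lemma apply_itemRole {R : Type*} [Ring R] (v : Fin 3 → R) (hy : y ∈ s) :
    v (itemRole s y x) =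
      (v 0 - v 1) * (if x = y then 1 else 0) + (v 1 - v 2) * (if x ∈ s then 1 else 0) + v 2 := by
  rcases eq_or_ne x y with rfl | hxy
  · simp [itemRole, hy]
  · by_cases hx : x ∈ s <;> simp [itemRole, hx, hxy]

lemma subset_of_image_itemRole_eq (hy : y ∈ s) (h : t.image (itemRole s y) = {0, 1}) :
    t ⊆ s := by
  intro x hx
  have hrole : itemRole s y x ∈ ({0, 1} : Finset (Fin 3)) := h ▸ Finset.mem_image_of_mem _ hx
  by_contra hxs
  have hxy : x ≠ y := (ne_of_mem_of_not_mem hy hxs).symm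
  simp [itemRole, hxs, hxy] at hrole

lemma image_itemRole_self (hy : y ∈ s) (hx : x ∈ s) (hxy : x ≠ y) :
    s.image (itemRole s y) = {0, 1} := by
  ext r
  simp only [Finset.mem_image, Finset.mem_insert, Finset.mem_singleton]
  constructor
  · rintro ⟨z, hz, rfl⟩
    by_cases hzy : z = y <;> simp [itemRole, hz, hzy]
  · rintro (rfl | rfl)
    · exact ⟨y, hy, by simp [itemRole]⟩
    · exact ⟨x, hx, by simp [itemRole, hx, hxy]⟩

end ItemRole

/-- The scores obtained from utilities `u` of three items by giving each item of `X` the utilities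
of its role relative to `s` and `y`. -/
def roleScores {X : Type*} [DecidableEq X] {k : ℕ} (u : Fin k → Fin 3 → ℝ) (s : Finset X) (y : X) :
    Fin k → X → ℝ :=
  fun i => u i ∘ itemRole s y

namespace AggregationMechanism

section RoleScores

variable {M : AggregationMechanism} {X : Type*} [DecidableEq X] {k : ℕ} {u : Fin k → Fin 3 → ℝ}
  {s t : Finset X} {x x' y : X}

lemma margin_roleScores (M : AggregationMechanism) (u : Fin k → Fin 3 → ℝ) (s t : Finset X)
    (x x' y : X) :
    M.margin (roleScores u s y) x x' t =
      M.margin u (itemRole s y x) (itemRole s y x') (t.image (itemRole s y)) :=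
  M.margin_comp u (itemRole s y) x x' t

lemma IsTripleBasis.margin_pos (hu : M.IsTripleBasis u) : 0 < M.margin u 0 1 {0, 1} :=
  sub_pos.2 hu.1

lemma IsTripleBasis.neg_margin_le (hu : M.IsTripleBasis u) {S : Finset (Fin 3)} {r r' : Fin 3}
    (hr : r ∈ S) (hr' : r' ∈ S) : -M.margin u 0 1 {0, 1} ≤ M.margin u r r' S := by
  have hpos := hu.1
  unfold margin
  by_cases hS : S = {0, 1}
  · subst hS
    simp only [Finset.mem_insert, Finset.mem_singleton] at hr hr'
    rcases hr with rfl | rfl <;> rcases hr' with rfl | rfl <;> linarith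
  · linarith [hu.2 S hS r hr r' hr']

lemma IsTripleBasis.neg_margin_le_margin_roleScores (hu : M.IsTripleBasis u) (hx : x ∈ t)
    (hx' : x' ∈ t) : -M.margin u 0 1 {0, 1} ≤ M.margin (roleScores u s y) x x' t := by
  rw [margin_roleScores]
  exact hu.neg_margin_le (Finset.mem_image_of_mem _ hx) (Finset.mem_image_of_mem _ hx')

lemma IsTripleBasis.margin_roleScores_eq_zero (hu : M.IsTripleBasis u) (hy : y ∈ s)
    (hts : ¬t ⊆ s) (hx : x ∈ t) (hx' : x' ∈ t) : M.margin (roleScores u s y) x x' t = 0 := by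
  rw [margin_roleScores]
  exact sub_eq_zero.2 (hu.2 _ (mt (subset_of_image_itemRole_eq hy) hts)
    _ (Finset.mem_image_of_mem _ hx) _ (Finset.mem_image_of_mem _ hx'))

lemma margin_roleScores_self (M : AggregationMechanism) (u : Fin k → Fin 3 → ℝ) (hy : y ∈ s)
    (hx : x ∈ s) (hxy : x ≠ y) :
    M.margin (roleScores u s y) y x s = M.margin u 0 1 {0, 1} := by
  rw [margin_roleScores, image_itemRole_self hy hx hxy]
  simp [itemRole, hx, hxy]

lemma ScalesBy.margin_roleScores_smul {α κ : ℝ} (h : M.ScalesBy α κ) (u : Fin k → Fin 3 → ℝ)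
    (hx : x ∈ t) (hx' : x' ∈ t) :
    M.margin (roleScores (α • u) s y) x x' t = κ * M.margin (roleScores u s y) x x' t := by
  simp only [margin_roleScores]
  exact h.margin_smul u (Finset.mem_image_of_mem _ hx) (Finset.mem_image_of_mem _ hx')

end RoleScores

end AggregationMechanism

section Realization

variable {X : Type*} {n : ℕ}

/-- The decision rule of `g` is the choice function `c`, without ties on any choice set. -/
def Realizes (g : X → Finset X → ℝ) (c : ChoiceSet X n → X) : Prop :=
  ∀ s : ChoiceSet X n, decision g s.1 = {c s}

lemma decision_eq_singleton_iff {g : X → Finset X → ℝ} {s : Finset X} {y : X} (hy : y ∈ s) :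
    decision g s = {y} ↔ ∀ x ∈ s, x ≠ y → g x s < g y s := by
  constructor
  · intro h x hx hxy
    by_contra! hle
    have hmax : y ∈ decision g s := h ▸ Set.mem_singleton y
    have hx_mem : x ∈ decision g s := ⟨hx, fun z hz => (hmax.2 z hz).trans hle⟩
    exact hxy (h ▸ hx_mem : x ∈ ({y} : Set X))
  · refine fun h => Set.eq_singleton_iff_unique_mem.2 ⟨⟨hy, fun x hx => ?_⟩, fun x hx => ?_⟩
    · rcases eq_or_ne x y with rfl | hxy
      exacts [le_rfl, (h x hx hxy).le]
    · by_contra hxy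
      exact (h x hx.1 hxy).not_ge (hx.2 y hy)

lemma AggregationMechanism.realizes_agg_iff {M : AggregationMechanism} {ℓ : ℕ}
    {f : Fin ℓ → X → ℝ} {c : ChoiceSet X n → X} (hc : ∀ s, c s ∈ s.1) :
    Realizes (M.agg f) c ↔ ∀ s, ∀ x ∈ s.1, x ≠ c s → 0 < M.margin f (c s) x s.1 := by
  simp only [Realizes, decision_eq_singleton_iff (hc _), AggregationMechanism.margin, sub_pos]

variable [Fintype X]

theorem AggregationMechanism.IsTripleBasis.exists_realizes [DecidableEq X]
    {M : AggregationMechanism} {k ℓ : ℕ} {u : Fin k → Fin 3 → ℝ} (hu : M.IsTripleBasis u)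
    (hM : M.DiscretelyScaleInvariant) (hℓ : Fintype.card (ChoiceSet X n) * k ≤ ℓ)
    {c : ChoiceSet X n → X} (hc : ∀ s, c s ∈ s.1) :
    ∃ f : Fin ℓ → X → ℝ, Realizes (M.agg f) c ∧
      ∀ j, f j = 0 ∨ ∃ (s : ChoiceSet X n) (v : Fin 3 → ℝ), f j = v ∘ itemRole s.1 (c s) := by
  obtain ⟨α, B, hB, hscale⟩ := hM.exists_scalesBy_gt (Fintype.card (ChoiceSet X n))
  let d : ChoiceSet X n → ℕ := fun s => n - s.1.card
  obtain ⟨f, hf, hmargin⟩ :=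
    M.exists_margin_eq_sum (fun s => roleScores (α ^ d s • u) s.1 (c s)) hℓ
  refine ⟨f, (M.realizes_agg_iff hc).2 fun t x hx hxc => ?_,
    fun j => (hf j).imp_right fun ⟨s, i, h⟩ => ⟨s, _, h⟩⟩
  simp only [hmargin, (hscale.pow _).margin_roleScores_smul u (hc t) hx]
  have hself := M.margin_roleScores_self u (hc t) hx hxc
  refine sum_pow_mul_pos_of_leading hB (j := t) (hself ▸ hu.margin_pos)
    (fun s _ => hself ▸ hu.neg_margin_le_margin_roleScores (hc t) hx) fun s hst hd => ?_
  have hcard : s.1.card ≤ t.1.card := (Nat.sub_le_sub_iff_left s.2.2).1 hd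
  have hts : ¬t.1 ⊆ s.1 := fun hsub =>
    hst (Subtype.ext (Finset.eq_of_subset_of_card_le hsub hcard).symm)
  exact (hu.margin_roleScores_eq_zero (hc s) hts (hc t) hx).ge

lemma risk_nonneg (D : PMF (ChoiceSet X n × X)) (g : X → Finset X → ℝ) : 0 ≤ risk D g :=
  Finset.sum_nonneg fun p _ => mul_nonneg ENNReal.toReal_nonneg <| by
    unfold zeroOneLoss
    split_ifs <;> norm_num

variable {D : PMF (ChoiceSet X n × X)} {g : X → Finset X → ℝ} {c : ChoiceSet X n → X}

lemma Realizes.risk_eq_zero (hg : Realizes g c) (hD : ∀ p ∈ D.support, p.2 = c p.1) :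
    risk D g = 0 := by
  refine Finset.sum_eq_zero fun p _ => ?_
  by_cases hp : p ∈ D.support
  · simp [zeroOneLoss, hg p.1, hD p hp]
  · simp [(D.apply_eq_zero_iff p).2 hp]

lemma approxError_eq_zero {G : Set (X → Finset X → ℝ)} (hgG : g ∈ G) (hg : risk D g = 0) :
    approxError D G = 0 :=
  IsLeast.csInf_eq ⟨⟨g, hgG, hg⟩, by rintro _ ⟨g', -, rfl⟩; exact risk_nonneg D g'⟩

lemma Realizes.approxError_eq_zero_and_attained {G : Set (X → Finset X → ℝ)} (hg : Realizes g c)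
    (hD : ∀ p ∈ D.support, p.2 = c p.1) (hgG : g ∈ G) :
    approxError D G = 0 ∧ ∃ g ∈ G, risk D g = 0 :=
  have hrisk : risk D g = 0 := hg.risk_eq_zero hD
  ⟨approxError_eq_zero hgG hrisk, g, hgG, hrisk⟩

end Realization

namespace AggregationMechanism.ContinuousInUtilities

variable {M : AggregationMechanism} {X : Type*} {n ℓ : ℕ} {c : ChoiceSet X n → X}

lemma continuous_agg (hM : M.ContinuousInUtilities) {s : Finset X} {x : X} (hx : x ∈ s) :
    Continuous fun f : Fin ℓ → X → ℝ => M.agg f x s := by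
  classical
  let q : Fin s.card → X := fun j => s.equivFin.symm j
  have hq : Finset.univ.image q = s := by
    ext z
    simp only [Finset.mem_image, Finset.mem_univ, true_and]
    exact ⟨fun ⟨j, hj⟩ => hj ▸ (s.equivFin.symm j).2, fun hz => ⟨s.equivFin ⟨z, hz⟩, by simp [q]⟩⟩
  have hqx : q (s.equivFin ⟨x, hx⟩) = x := by simp [q]
  have hagg : ∀ f : Fin ℓ → X → ℝ,
      M.agg f x s = M.agg (fun i => f i ∘ q) (s.equivFin ⟨x, hx⟩) Finset.univ := by
    intro f
    rw [M.agg_comp, hq, hqx]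
  simp only [hagg]
  exact (hM s.card ℓ Finset.univ _ (Finset.mem_univ _)).comp (by fun_prop)

lemma isOpen_setOf_realizes [Finite X] (hM : M.ContinuousInUtilities) (hc : ∀ s, c s ∈ s.1) :
    IsOpen {f : Fin ℓ → X → ℝ | Realizes (M.agg f) c} := by
  simp only [realizes_agg_iff hc, Set.ofPred_forall]
  exact isOpen_iInter_of_finite fun s => isOpen_iInter_of_finite fun x =>
    isOpen_iInter_of_finite fun hx => isOpen_iInter_of_finite fun _ =>
      isOpen_lt continuous_const ((hM.continuous_agg (hc s)).sub (hM.continuous_agg hx))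

lemma exists_realizes_of_mem_closure [Finite X] (hM : M.ContinuousInUtilities)
    (hc : ∀ s, c s ∈ s.1) {H : Set (X → ℝ)} {f : Fin ℓ → X → ℝ} (hf : Realizes (M.agg f) c)
    (hfH : ∀ j, f j ∈ closure H) :
    ∃ f' : Fin ℓ → X → ℝ, Realizes (M.agg f') c ∧ ∀ j, f' j ∈ H := by
  have hmem : f ∈ closure (Set.univ.pi fun _ => H) := by
    rw [closure_pi_set]
    exact fun j _ => hfH j
  obtain ⟨f', hf', hf'H⟩ := mem_closure_iff.1 hmem _ (hM.isOpen_setOf_realizes hc) hf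
  exact ⟨f', hf', fun j => hf'H j (Set.mem_univ j)⟩

end AggregationMechanism.ContinuousInUtilities

section Networks

variable {σ : ℝ → ℝ}

lemma IsSigmoidal.tendsto_comp_mul_sub (hσ : IsSigmoidal σ) {ι : Type*} {l : Filter ι}
    {r z : ι → ℝ} {a θ : ℝ} (hr : Tendsto r l atTop) (hz : Tendsto z l (𝓝 a)) (ha : a ≠ θ) :
    Tendsto (fun i => σ (r i * (z i - θ))) l (𝓝 (if θ < a then 1 else 0)) := by
  have hsub : Tendsto (fun i => z i - θ) l (𝓝 (a - θ)) := hz.sub_const θ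
  split_ifs with h
  · exact hσ.2.comp (hr.atTop_mul_pos (sub_pos.2 h) hsub)
  · exact hσ.1.comp (hr.atTop_mul_neg (sub_neg.2 (ha.lt_of_le (not_lt.1 h))) hsub)

/-- The small network with slope `r` in both hidden layers: the first layer compares the inputs with
the thresholds `θ`, and the second compares the activations of the first with `1 / 2`. -/
noncomputable def steepNet (σ : ℝ → ℝ) (θ a : Fin 2 → ℝ) (β r : ℝ) : (Fin 2 → ℝ) → ℝ :=
  smallNet σ (Matrix.diagonal fun _ => r) (-(r • θ)) (Matrix.diagonal fun _ => r)
    (fun _ => -(r * (1 / 2))) a β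

lemma steepNet_apply (σ : ℝ → ℝ) (θ a : Fin 2 → ℝ) (β r : ℝ) (v : Fin 2 → ℝ) :
    steepNet σ θ a β r v = ∑ i, a i * σ (r * (σ (r * (v i - θ i)) - 1 / 2)) + β := by
  simp only [steepNet, smallNet, dotProduct, Matrix.mulVec_diagonal, Pi.add_apply, Pi.neg_apply,
    Pi.smul_apply, smul_eq_mul, mul_add, mul_neg, sub_eq_add_neg]

lemma IsSigmoidal.tendsto_steepNet (hσ : IsSigmoidal σ) {θ v : Fin 2 → ℝ} (hv : ∀ i, v i ≠ θ i)
    (a : Fin 2 → ℝ) (β : ℝ) :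
    Tendsto (fun r => steepNet σ θ a β r v) atTop
      (𝓝 (∑ i, a i * (if θ i < v i then 1 else 0) + β)) := by
  simp only [steepNet_apply]
  refine (tendsto_finsetSum _ fun i _ => Tendsto.const_mul (a i) ?_).add_const β
  have hfirst := hσ.tendsto_comp_mul_sub tendsto_id tendsto_const_nhds (hv i)
  have hsecond := hσ.tendsto_comp_mul_sub (θ := 1 / 2) tendsto_id hfirst
    (by split_ifs <;> norm_num)
  have hstep : (if 1 / 2 < (if θ i < v i then 1 else 0 : ℝ) then 1 else 0 : ℝ) =
      if θ i < v i then 1 else 0 := by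
    by_cases h : θ i < v i <;> norm_num [h]
  exact hstep ▸ hsecond

variable {X : Type*} [Finite X]

lemma Separates.exists_threshold {f : X → ℝ} {s : Finset X} (h : Separates f s) :
    ∃ θ : ℝ, (∀ x, f x ≠ θ) ∧ ∀ x, θ < f x ↔ x ∈ s := by
  obtain ⟨θ, hlow, hhigh⟩ := Set.Finite.exists_between' (Set.toFinite (f '' (↑s)ᶜ))
    (Set.toFinite (f '' ↑s)) (by rintro _ ⟨x', hx', rfl⟩ _ ⟨x, hx, rfl⟩; exact h x hx x' hx')
  have hin : ∀ x ∈ s, θ < f x := fun x hx => hhigh _ (Set.mem_image_of_mem f hx)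
  have hout : ∀ x ∉ s, f x < θ := fun x hx => hlow _ (Set.mem_image_of_mem f hx)
  refine ⟨θ, fun x => ?_, fun x => ⟨fun hx => ?_, hin x⟩⟩
  · by_cases hx : x ∈ s
    exacts [(hin x hx).ne', (hout x hx).ne]
  · by_contra hxs
    exact (hout x hxs).not_gt hx

variable [DecidableEq X]

lemma comp_itemRole_mem_closure_enrichedClass (hσ : IsSigmoidal σ) {F : Set (X → ℝ)}
    {s : Finset X} {y : X} (hy : y ∈ s) {b b' : X → ℝ} (hb : b ∈ F) (hb' : b' ∈ F)
    (hsep : Separates b {y}) (hsep' : Separates b' s) (v : Fin 3 → ℝ) :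
    v ∘ itemRole s y ∈ closure (enrichedClass σ F) := by
  obtain ⟨θ, hne, hiff⟩ := hsep.exists_threshold
  obtain ⟨θ', hne', hiff'⟩ := hsep'.exists_threshold
  refine mem_closure_of_tendsto (b := atTop)
    (f := fun r x => steepNet σ ![θ, θ'] ![v 0 - v 1, v 1 - v 2] (v 2) r ![b x, b' x])
    (tendsto_pi_nhds.2 fun x => ?_)
    (Eventually.of_forall fun r => ⟨_, _, _, _, _, _, b, hb, b', hb', rfl⟩)
  have hx : ∀ i, ![b x, b' x] i ≠ ![θ, θ'] i := Fin.forall_fin_two.2 ⟨hne x, hne' x⟩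
  rw [Function.comp_apply, apply_itemRole v hy]
  simpa [Fin.sum_univ_two, hiff, hiff'] using
    hσ.tendsto_steepNet hx ![v 0 - v 1, v 1 - v 2] (v 2)

lemma SeparatesChoiceSets.comp_itemRole_mem_closure (hσ : IsSigmoidal σ) {F : Set (X → ℝ)}
    {n : ℕ} (hF : SeparatesChoiceSets F n) (s : ChoiceSet X n) {y : X} (hy : y ∈ s.1)
    (v : Fin 3 → ℝ) : v ∘ itemRole s.1 y ∈ closure (enrichedClass σ F) := by
  have hn : ({y} : Finset X).card ≤ n :=
    (Finset.card_le_card (Finset.singleton_subset_iff.2 hy)).trans s.2.2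
  obtain ⟨b, hb, hsep⟩ := hF ⟨{y}, Finset.singleton_nonempty y, hn⟩
  obtain ⟨b', hb', hsep'⟩ := hF s
  exact comp_itemRole_mem_closure_enrichedClass hσ hy hb hb' hsep hsep' v

end Networks

theorem mainTheorem2_general {X : Type*} [Fintype X] (n : ℕ)
    (M : AggregationMechanism) (hscale : M.DiscretelyScaleInvariant)
    {k : ℕ} (u : Fin k → Fin 3 → ℝ) (hu : M.IsTripleBasis u) :
    ∃ ℓ₀ : ℕ, ∀ ℓ : ℕ, ℓ₀ ≤ ℓ →
      ∀ c : ChoiceSet X n → X, (∀ s, c s ∈ s.1) →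
      ∀ D : PMF (ChoiceSet X n × X), (∀ p ∈ D.support, p.2 = c p.1) →
        (approxError D (M.aggClass ℓ Set.univ) = 0 ∧
          ∃ g ∈ M.aggClass ℓ Set.univ, risk D g = 0) ∧
        (M.ContinuousInUtilities →
          ∀ σ : ℝ → ℝ, IsSigmoidal σ →
          ∀ F : Set (X → ℝ), SeparatesChoiceSets F n →
          ∀ H : Set (X → ℝ), enrichedClass σ F ⊆ H →
            approxError D (M.aggClass ℓ H) = 0 ∧ ∃ g ∈ M.aggClass ℓ H, risk D g = 0) := by
  classical
  refine ⟨Fintype.card (ChoiceSet X n) * k, fun ℓ hℓ c hc D hD => ?_⟩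
  obtain ⟨f, hf, hrole⟩ := hu.exists_realizes hscale hℓ hc
  refine ⟨hf.approxError_eq_zero_and_attained hD ⟨f, fun _ => Set.mem_univ _, rfl⟩,
    fun hcont σ hσ F hF H hH => ?_⟩
  have hclosure : ∀ j, f j ∈ closure (enrichedClass σ F) := by
    intro j
    rcases hrole j with hzero | ⟨s, v, hv⟩
    · obtain ⟨⟨s, _⟩, _⟩ := D.support_nonempty
      exact hzero ▸ hF.comp_itemRole_mem_closure hσ s (hc s) 0
    · exact hv ▸ hF.comp_itemRole_mem_closure hσ s (hc s) v
  obtain ⟨f', hf', hf'F⟩ := hcont.exists_realizes_of_mem_closure hc hf hclosure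
  exact hf'.approxError_eq_zero_and_attained hD ⟨f', fun j => hH (hf'F j), rfl⟩

theorem mainTheorem2 {X : Type*} [Fintype X] (n : ℕ)
    (M : AggregationMechanism) (hscale : M.ScaleInvariant)
    {k : ℕ} (u : Fin k → Fin 3 → ℝ) (hu : M.IsTripleBasis u) :
    ∃ ℓ₀ : ℕ, ∀ ℓ : ℕ, ℓ₀ ≤ ℓ →
      ∀ c : ChoiceSet X n → X, (∀ s, c s ∈ s.1) →
      ∀ D : PMF (ChoiceSet X n × X), (∀ p ∈ D.support, p.2 = c p.1) →
        (approxError D (M.aggClass ℓ Set.univ) = 0 ∧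
          ∃ g ∈ M.aggClass ℓ Set.univ, risk D g = 0) ∧
        (M.ContinuousInUtilities →
          ∀ σ : ℝ → ℝ, IsSigmoidal σ →
          ∀ F : Set (X → ℝ), SeparatesChoiceSets F n →
          ∀ H : Set (X → ℝ), enrichedClass σ F ⊆ H →
            approxError D (M.aggClass ℓ H) = 0 ∧ ∃ g ∈ M.aggClass ℓ H, risk D g = 0) :=
  mainTheorem2_general n M hscale.discretelyScaleInvariant u hu
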